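/- Let $p$ be a prime and let $X$ be a finite connected directed graph (loops and multiple edges allowed; connected means that the undirected graph $X'$ obtained by forgetting the orientation of the edges is connected) that is balanced, i.e. the in-degree $d_i(v)$ equals the out-degree $d_o(v)$ for every vertex $v$. Let $k=\sum_v d_i(v)$, let $\kappa_X$ be the number of spanning trees of $X'$ (a multigraph with one edge for every edge of $X$), let $A$ be the adjacency matrix of $X$, let $D$ be the diagonal matrix with entries $d_i(v)+d_o(v)$, and put $M_X(T)=\det\bigl(D-A(1+T)-A^{t}(1+T)^{-1}\bigr)\in\mathbb{Z}_p[[T]]$. Then \[ M_X(T)\equiv -k\,\kappa_X\,T^2 \pmod{T^3}. \] Let $\tilde X$ be the directed graph obtained from $X$ by adding, for each edge $e$, a supplementary edge in the opposite direction; the weight of a directed path in $\tilde X$ is the number of its edges that belong to $X$ minus the number of its supplementary edges. Suppose in addition that $p>2$ or $\tilde X$ contains a (directed) cycle whose weight is coprime to $p$, and that $p\nmid k\kappa_X$. Then the constant $\mathbb{Z}_p$-tower of $X$ has invariants $\mu(X)=0$ and $\lambda(X)=1$. Explicitly: let $a\in\mathbb{Z}_p^\times$; for $n\ge 0$ let $X_n$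 be the derived graph with vertex set $V(X)\times\mathbb{Z}/p^n$ and edge set $E(X)\times\mathbb{Z}/p^n$, where an edge $e$ from $s$ to $t$ gives the edges $(e,\sigma)$ from $(s,\sigma)$ to $(t,\sigma+a)$; and let $r_n$ be the number of connected components of $X_n$. Then there is a least $n_0\ge 0$ with $r_n=r_{n_0}$ for all $n\ge n_0$, and for every connected component $C$ of $X_{n_0}$ there is an integer $\nu$ such that, for all sufficiently large $n$, the number $\kappa_n$ of spanning trees of the undirected graph underlying the preimage of $C$ in $X_{n_0+n}$ is non-zero and satisfies $\operatorname{ord}_p(\kappa_n)=\mu p^n+\lambda n+\nu$ with $\mu=0$ and $\lambda=1$. -/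

import Mathlib

/-- A directed graph with vertex set `V` and edge set `E`; loops and multiple edges are allowed.
The edge `e` goes from `src e` to `tgt e`. -/
structure DiMultigraph (V E : Type*) where
  src : E → V
  tgt : E → V

namespace DiMultigraph

/-- The number of edges leaving `v`. -/
noncomputable def outDegree {V E : Type*} (X : DiMultigraph V E) (v : V) : ℕ :=
  Nat.card {e : E // X.src e = v}

/-- The number of edges entering `v`. -/
noncomputable def inDegree {V E : Type*} (X : DiMultigraph V E) (v : V) : ℕ :=
  Nat.card {e : E // X.tgt e = v}

/-- Every vertex has equal in-degree and out-degree. -/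
def IsBalanced {V E : Type*} (X : DiMultigraph V E) : Prop :=
  ∀ v, X.inDegree v = X.outDegree v

/-- The sum of the in-degrees of all vertices. -/
noncomputable def totalInDegree {V E : Type*} [Fintype V] (X : DiMultigraph V E) : ℕ :=
  ∑ v, X.inDegree v

/-- The adjacency relation of the undirected graph with vertex set `V` and edge set `S`, where `S`
is a set of edges of `X` whose orientation is forgotten. Loops and multiplicities play no role for
connectedness, so it can be recorded as a simple graph. -/
def edgeGraph {V E : Type*} (X : DiMultigraph V E) (S : Set E) : SimpleGraph V :=
  SimpleGraph.fromRel fun u v => ∃ e ∈ S, X.src e = u ∧ X.tgt e = v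

/-- A directed graph is connected if the undirected graph obtained by forgetting the orientation
of the edges is connected (in particular it is non-empty). -/
def Connected {V E : Type*} (X : DiMultigraph V E) : Prop :=
  (X.edgeGraph Set.univ).Connected

/-- The connected components of the undirected graph obtained by forgetting the orientation. -/
abbrev Component {V E : Type*} (X : DiMultigraph V E) : Type _ :=
  (X.edgeGraph Set.univ).ConnectedComponent

/-- The connected component of a vertex. -/
def component {V E : Type*} (X : DiMultigraph V E) (v : V) : X.Component :=
  (X.edgeGraph Set.univ).connectedComponentMk v

/-- The edge set `S` is a spanning tree of the undirected multigraph obtained from the finite graph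
`X` by forgetting the orientation: `(V, S)` is connected and has exactly `|V| - 1` edges. -/
def IsSpanningTree {V E : Type*} (X : DiMultigraph V E) (S : Set E) : Prop :=
  (X.edgeGraph S).Connected ∧ S.ncard + 1 = Nat.card V

/-- The number `κ_X` of spanning trees of the undirected multigraph underlying the finite graph
`X`. Parallel edges are distinct edges, so they give distinct spanning trees. -/
noncomputable def numSpanningTrees {V E : Type*} (X : DiMultigraph V E) : ℕ :=
  {S : Set E | X.IsSpanningTree S}.ncard

/-- The graph `X̃`: the edges are those of `X` (`Sum.inl e`) together with, for each edge `e` of `X`,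
a supplementary edge `Sum.inr e` in the opposite direction. -/
def double {V E : Type*} (X : DiMultigraph V E) : DiMultigraph V (E ⊕ E) where
  src := Sum.elim X.src X.tgt
  tgt := Sum.elim X.tgt X.src

/-- The list `l` of edges is a directed path from `u` to `v`. -/
def IsPath {V E : Type*} (X : DiMultigraph V E) : V → List E → V → Prop
  | u, [], v => u = v
  | u, e :: l, v => X.src e = u ∧ X.IsPath (X.tgt e) l v

/-- A cycle is a directed path with at least one edge that ends at the vertex where it starts. -/
def IsCycle {V E : Type*} (X : DiMultigraph V E) (l : List E) : Prop :=
  l ≠ [] ∧ ∃ v, X.IsPath v l v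

/-- The weight of a list of edges of `X̃`: the number of edges that belong to `X` minus the number of
supplementary edges. -/
def weight {E : Type*} (l : List (E ⊕ E)) : ℤ :=
  (l.map (Sum.elim (fun _ => (1 : ℤ)) (fun _ => -1))).sum

/-- The derived graph of the voltage assignment `α : E → G`: an edge `e` from `s` to `t` gives, for
every `σ : G`, an edge `(e, σ)` from `(s, σ)` to `(t, σ + α e)`. -/
def derived {V E G : Type*} [AddGroup G] (X : DiMultigraph V E) (α : E → G) :
    DiMultigraph (V × G) (E × G) where
  src e := (X.src e.1, e.2)
  tgt e := (X.tgt e.1, e.2 + α e.1)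

/-- The graph `X_n`: the derived graph of the `ℤ/pⁿ`-valued voltage assignment which is the
reduction of the constant `ℤ_p`-valued voltage assignment with value `a`. -/
noncomputable def constantCover {V E : Type*} (X : DiMultigraph V E) (p : ℕ) [Fact p.Prime] (a : ℤ_[p]) (n : ℕ) :
    DiMultigraph (V × ZMod (p ^ n)) (E × ZMod (p ^ n)) :=
  X.derived fun _ => PadicInt.toZModPow n a

/-- The number `r_n` of connected components of `X_n`. -/
noncomputable def numComponents {V E : Type*} (X : DiMultigraph V E) (p : ℕ) [Fact p.Prime]
    (a : ℤ_[p]) (n : ℕ) : ℕ :=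
  Nat.card (X.constantCover p a n).Component

/-- The subgraph induced on a set `U` of vertices. -/
def induce {V E : Type*} (X : DiMultigraph V E) (U : Set V) :
    DiMultigraph U {e : E // X.src e ∈ U ∧ X.tgt e ∈ U} where
  src e := ⟨X.src e.1, e.2.1⟩
  tgt e := ⟨X.tgt e.1, e.2.2⟩

/-- The projection from the vertices of `X_{m+n}` to those of `X_m`. -/
def project {V : Type*} (p m n : ℕ) (w : V × ZMod (p ^ (m + n))) : V × ZMod (p ^ m) :=
  (w.1, ZMod.castHom (pow_dvd_pow p (Nat.le_add_right m n)) (ZMod (p ^ m)) w.2)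

/-- The set of vertices of `X_{m+n}` that lie above the connected component `C` of `X_m`. -/
def preimage {V E : Type*} (X : DiMultigraph V E) (p : ℕ) [Fact p.Prime] (a : ℤ_[p]) (m : ℕ)
    (C : (X.constantCover p a m).Component) (n : ℕ) : Set (V × ZMod (p ^ (m + n))) :=
  {w | (X.constantCover p a m).component (project p m n w) = C}

/-- The `n`-th layer of the tower above a connected component `C` of `X_m`: the preimage of `C` in
`X_{m+n}`. (No edge of `X_{m+n}` leaves this set of vertices, so the induced subgraph is the full
preimage.) -/
noncomputable def towerLayer {V E : Type*} (X : DiMultigraph V E) (p : ℕ) [Fact p.Prime] (a : ℤ_[p]) (m : ℕ)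
    (C : (X.constantCover p a m).Component) (n : ℕ) :=
  (X.constantCover p a (m + n)).induce (X.preimage p a m C n)

/-- The adjacency matrix of `X`, with entries in a semiring: the `(u, v)` entry is the number of
edges from `u` to `v`. -/
noncomputable def adjMatrix {V E : Type*} (X : DiMultigraph V E) (R : Type*) [Semiring R] :
    Matrix V V R :=
  Matrix.of fun u v => ((Nat.card {e : E // X.src e = u ∧ X.tgt e = v} : ℕ) : R)

/-- The diagonal matrix of the sums of in-degree and out-degree. -/
noncomputable def valencyMatrix {V E : Type*} [DecidableEq V] (X : DiMultigraph V E) (R : Type*)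
    [Semiring R] : Matrix V V R :=
  Matrix.diagonal fun v => ((X.inDegree v + X.outDegree v : ℕ) : R)

/-- `M_X(T) = det (D - A (1 + T) - Aᵗ (1 + T)⁻¹)`, a power series over `ℤ_p`.
Here `PowerSeries.invOfUnit (1 + T) 1` is the inverse of `1 + T`. -/
noncomputable def charSeries {V E : Type*} [Fintype V] [DecidableEq V] (X : DiMultigraph V E)
    (p : ℕ) [Fact p.Prime] : PowerSeries ℤ_[p] :=
  (X.valencyMatrix (PowerSeries ℤ_[p])
    - (1 + PowerSeries.X : PowerSeries ℤ_[p]) • X.adjMatrix (PowerSeries ℤ_[p])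
    - (PowerSeries.invOfUnit (1 + PowerSeries.X) 1 : PowerSeries ℤ_[p]) •
      (X.adjMatrix (PowerSeries ℤ_[p])).transpose).det

end DiMultigraph

/-- A sequence `κ` of non-zero natural numbers (the numbers of spanning trees in the layers of a
`ℤ_p`-tower) has Iwasawa invariants `μ` and `lam` at `p`: for some integer `ν`,
`ord_p (κ n) = μ pⁿ + lam n + ν` for all large `n`. -/
def HasIwasawaInvariants (p : ℕ) (κ : ℕ → ℕ) (μ lam : ℤ) : Prop :=
  ∃ ν : ℤ, ∀ᶠ n in Filter.atTop,
    κ n ≠ 0 ∧ (padicValNat p (κ n) : ℤ) = μ * (p : ℤ) ^ n + lam * (n : ℤ) + ν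

/-- The Iwasawa invariants are uniquely determined by the sequence. -/
theorem HasIwasawaInvariants.unique {p : ℕ} (hp : p.Prime) {κ : ℕ → ℕ} {μ lam μ' lam' : ℤ}
    (h : HasIwasawaInvariants p κ μ lam) (h' : HasIwasawaInvariants p κ μ' lam') :
    μ = μ' ∧ lam = lam' := by
  obtain ⟨ν, h⟩ := h
  obtain ⟨ν', h'⟩ := h'
  obtain ⟨N, hN⟩ := Filter.eventually_atTop.1 (h.and h')
  have key : ∀ n ≥ N, μ * (p : ℤ) ^ n + lam * (n : ℤ) + ν
      = μ' * (p : ℤ) ^ n + lam' * (n : ℤ) + ν' := fun n hn => by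
    rw [← (hN n hn).1.2, ← (hN n hn).2.2]
  have h0 := key N le_rfl
  have h1 := key (N + 1) (by omega)
  have h2 := key (N + 2) (by omega)
  push_cast [pow_succ] at h1 h2
  have hp2 : (2 : ℤ) ≤ p := by exact_mod_cast hp.two_le
  have hne : (p : ℤ) ^ N * ((p : ℤ) - 1) ^ 2 ≠ 0 :=
    mul_ne_zero (pow_ne_zero _ (by omega)) (pow_ne_zero _ (by omega))
  have hμ : μ = μ' := by
    refine mul_right_cancel₀ hne ?_
    linear_combination h2 - 2 * h1 + h0
  subst hμ
  exact ⟨rfl, by linear_combination h1 - h0⟩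

/-! Write `L(x, y) = D - x A - y Aᵗ`. For a balanced graph every row sum is a multiple of the
out-degree: `L(x, y) 1 = (2 - x - y) d`. Adding all columns to column `w` therefore gives `det L(x,
y) = (2 - x - y) c(x, y)`, where `c` is `degreeCofactor`. At `x = y = 1` the matrix-tree theorem
gives `c(1, 1) = k κ_X`. With `x = 1 + T` and `y = x⁻¹`, the factor `2 - x - y` is `-T² y`, which
gives the congruence.

For the tower put `N = pⁿ` and let `P` be the matrix of translation by `a` on `ℤ/N`. The Laplacian
of `X_n` is the block matrix `L(P, P⁻¹)`. It is singular, so a rank-one term is added before taking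
determinants. Computing the result blockwise and by the matrix-tree theorem for `X_n` gives `k κ_n =
N det c(P, P⁻¹)` (`IsBalanced.totalInDegree_mul_numSpanningTrees_derived`). Modulo `p` the matrix
`P` is unipotent, so `c(P, P⁻¹)` is the scalar `c(1, 1) = k κ_X` plus a nilpotent, hence invertible
(`not_dvd_det_evalTranslation`). Thus `ord_p κ_n = n` for every `n`. In particular `κ_n ≠ 0`, so
each `X_n` is connected, and `n₀ = 0`, `μ = 0`, `λ = 1`, `ν = 0`. -/

namespace Matrix

/-! ### Determinants of rank-one perturbations. -/

variable {n m R : Type*} [Fintype n] [DecidableEq n] [Fintype m] [CommRing R]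

theorem det_updateCol_mulVec_one (K : Matrix n n R) (w : n) :
    (K.updateCol w (K *ᵥ 1)).det = K.det := by
  have h := det_updateCol_sum K w 1
  have h1 : K *ᵥ 1 = fun k => ∑ i, K k i := by ext; simp [mulVec, dotProduct]
  simpa [h1] using h

/-- Outside column `w` the perturbation only adds multiples of `u`, which is column `w` itself. -/
theorem det_add_vecMulVec_updateCol (M : Matrix n n R) (u v : n → R) (w : n) :
    ((M + vecMulVec u v).updateCol w u).det = (M.updateCol w u).det := by
  rw [← det_transpose, ← det_transpose (M.updateCol w u)]
  refine det_eq_of_forall_row_eq_smul_add_const (Function.update v w 0) w (by simp) fun i j => ?_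
  by_cases h : i = w
  · subst h
    simp
  · simp [h, vecMulVec_apply, mul_comm]

theorem det_add_vecMulVec_of_mulVec_one {M : Matrix n n R} {u v : n → R} {r : R}
    (h : (M + vecMulVec u v) *ᵥ 1 = r • u) (w : n) :
    (M + vecMulVec u v).det = r * (M.updateCol w u).det := by
  rw [← det_updateCol_mulVec_one _ w, h, det_updateCol_smul, det_add_vecMulVec_updateCol]

theorem det_eq_mul_det_updateCol {M : Matrix n n R} {u : n → R} {r : R}
    (h : M *ᵥ 1 = r • u) (w : n) : M.det = r * (M.updateCol w u).det := by
  rw [← det_updateCol_mulVec_one _ w, h, det_updateCol_smul]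

/-- The vector `u - (∑ u) e_w` has coordinate sum zero, so placing it in column `w` leaves the
all-ones vector in the left kernel; that part contributes nothing. -/
theorem det_updateCol_eq_sum_mul [IsDomain R] {M : Matrix n n R} (h : 1 ᵥ* M = 0) (w : n)
    (u : n → R) :
    (M.updateCol w u).det = (∑ i, u i) * (M.updateCol w (Pi.single w 1)).det := by
  obtain ⟨z, hz⟩ : ∃ z, z = u - (∑ i, u i) • Pi.single w 1 := ⟨_, rfl⟩
  have hu : u = (∑ i, u i) • Pi.single w 1 + z := by rw [hz]; abel
  have hz0 : (M.updateCol w z).det = 0 := by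
    refine exists_vecMul_eq_zero_iff.1 ⟨1, fun h0 => one_ne_zero (congrFun h0 w), ?_⟩
    ext j
    have hj := congrFun h j
    by_cases hjw : j = w
    · subst hjw
      simp [vecMul, dotProduct, hz, ← Finset.mul_sum]
    · simpa [vecMul, dotProduct, updateCol_apply, hjw] using hj
  conv_lhs => rw [hu]
  rw [det_updateCol_add, det_updateCol_smul, hz0, add_zero]

theorem det_add_vecMulVec_of_one_mulVec_eq_zero [IsDomain R] {M : Matrix n n R}
    (hr : M *ᵥ 1 = 0) (hl : 1 ᵥ* M = 0) (u v : n → R) (w : n) :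
    (M + vecMulVec u v).det =
      (∑ i, u i) * (∑ i, v i) * (M.updateCol w (Pi.single w 1)).det := by
  have h : (M + vecMulVec u v) *ᵥ 1 = (∑ i, v i) • u := by
    rw [add_mulVec, hr, zero_add, vecMulVec_mulVec]
    ext i
    simp [dotProduct, mul_comm]
  rw [det_add_vecMulVec_of_mulVec_one h w, det_updateCol_eq_sum_mul hl]
  ring

theorem isUnit_det_of_forall_single {B : Matrix n n R}
    (h : ∀ i, Pi.single i 1 ∈ LinearMap.range B.mulVecLin) : IsUnit B.det := by
  rw [← isUnit_iff_isUnit_det, ← mulVec_surjective_iff_isUnit]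
  suffices LinearMap.range B.mulVecLin = ⊤ from LinearMap.range_eq_top.1 this
  rw [eq_top_iff, ← (Pi.basisFun R n).span_eq, Submodule.span_le]
  rintro _ ⟨i, rfl⟩
  simpa using h i

theorem col_mem_range_mulVecLin (B : Matrix n n R) (i : n) :
    (fun k => B k i) ∈ LinearMap.range B.mulVecLin :=
  ⟨Pi.single i 1, by ext; simp⟩

/-! ### The Cauchy–Binet formula. -/

theorem det_mul_eq_sum_det_submatrix (M : Matrix n m R) (N : Matrix m n R) :
    (M * N).det = ∑ f : n → m, (M.submatrix id f).det * ∏ i, N (f i) i := by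
  simp only [det_apply', mul_apply, Finset.prod_univ_sum, Finset.mul_sum, Fintype.piFinset_univ,
    Finset.sum_mul, submatrix_apply, id]
  rw [Finset.sum_comm]
  simp only [Finset.prod_mul_distrib, mul_assoc]

/-- A form of the Cauchy–Binet formula. -/
theorem det_mul_eq_sum_powersetCard [DecidableEq m] (M : Matrix n m R) (N : Matrix m n R) (c : Finset m → R)
    (hc : ∀ (T : Finset m) (e : n ≃ T),
      (M.submatrix id fun i => (e i : m)).det * (N.submatrix (fun i => (e i : m)) id).det = c T) :
    (M * N).det = ∑ T ∈ Finset.powersetCard (Fintype.card n) Finset.univ, c T := by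
  -- A non-injective `f` repeats a column and contributes zero; the injective ones are grouped by
  -- their image `T`.
  rw [det_mul_eq_sum_det_submatrix,
    ← Finset.sum_subset (Finset.subset_univ (Finset.univ.filter Function.Injective))
    (fun f _ hf => by
      obtain ⟨i, j, hij, hne⟩ : ∃ i j, f i = f j ∧ i ≠ j := by
        simpa [Function.Injective] using hf
      rw [det_zero_of_column_eq hne fun k => by simp [hij], zero_mul]),
    ← Finset.sum_fiberwise_of_maps_to (g := fun f => Finset.univ.image f)
      (t := Finset.powersetCard (Fintype.card n) Finset.univ)
      (fun f hf => by
        simp [Finset.mem_powersetCard, Finset.card_image_of_injective _ (Finset.mem_filter.1 hf).2])]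
  refine Finset.sum_congr rfl fun T hT => ?_
  obtain ⟨e⟩ : Nonempty (n ≃ T) :=
    Fintype.card_eq.1 (by simp [(Finset.mem_powersetCard.1 hT).2])
  rw [← hc T e, det_apply' (N.submatrix _ _), Finset.mul_sum]
  symm
  -- Injections with image `T` are the fixed bijection `e` precomposed with permutations; their
  -- signs rebuild the second determinant.
  refine Finset.sum_bij (fun σ _ i => (e (σ i) : m)) ?_ ?_ ?_ ?_
  · intro σ _
    simp only [Finset.mem_filter, Finset.mem_univ, true_and]
    refine ⟨fun i j h => σ.injective (e.injective (Subtype.ext h)), ?_⟩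
    ext t
    simp only [Finset.mem_image, Finset.mem_univ, true_and]
    exact ⟨by rintro ⟨i, rfl⟩; exact (e (σ i)).2, fun ht => ⟨σ.symm (e.symm ⟨t, ht⟩), by simp⟩⟩
  · intro σ _ τ _ h
    ext i
    exact e.injective (Subtype.ext (congrFun h i))
  · intro f hf
    simp only [Finset.mem_filter, Finset.mem_univ, true_and] at hf
    have hm : ∀ i, f i ∈ T := fun i => hf.2 ▸ Finset.mem_image_of_mem f (Finset.mem_univ i)
    have hinj : Function.Injective fun i => e.symm ⟨f i, hm i⟩ := fun i j h => hf.1 (by simpa using h)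
    exact ⟨Equiv.ofBijective _ (Finite.injective_iff_bijective.1 hinj), Finset.mem_univ _,
      by ext i; simp⟩
  · intro σ _
    have : (M.submatrix id fun i => (e (σ i) : m)) =
      (M.submatrix id fun i => (e i : m)).submatrix id σ := rfl
    rw [this, det_permute']
    simp only [submatrix_apply, id]
    ring

end Matrix

/-! ### Kirchhoff's matrix-tree theorem. -/

namespace DiMultigraph

open Matrix

theorem edgeGraph_adj {V E : Type*} (X : DiMultigraph V E) (S : Set E) {u v : V} :
    (X.edgeGraph S).Adj u v ↔
      u ≠ v ∧ ∃ e ∈ S, (X.src e = u ∧ X.tgt e = v) ∨ (X.src e = v ∧ X.tgt e = u) := by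
  simp only [edgeGraph, SimpleGraph.fromRel_adj]
  grind

/-- The signed incidence matrix of `X` with an additional column, the indicator of `w`. -/
def rootedIncidence {V E : Type*} [DecidableEq V] (X : DiMultigraph V E) (w : V) :
    Matrix V (Option E) ℤ :=
  Matrix.of fun v o => o.elim (if w = v then 1 else 0)
    fun e => (if X.tgt e = v then 1 else 0) - (if X.src e = v then 1 else 0)

/-- The edges of `X` that occur in a set of columns of `rootedIncidence`. -/
def edgesOf {E : Type*} (T : Finset (Option E)) : Set E := {e | some e ∈ T}

variable {V E : Type*} [Fintype V] [DecidableEq V]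

theorem det_rootedIncidence_of_none_notMem (X : DiMultigraph V E) (w : V)
    {T : Finset (Option E)} (hT : none ∉ T) (e : V ≃ T) :
    ((X.rootedIncidence w).submatrix id fun i => (e i : Option E)).det = 0 := by
  refine exists_vecMul_eq_zero_iff.1 ⟨1, fun h0 => one_ne_zero (congrFun h0 w), ?_⟩
  ext j
  rcases h : (e j : Option E) with _ | f
  · exact absurd (h ▸ (e j).2) hT
  · simp [vecMul, dotProduct, rootedIncidence, h]

theorem det_rootedIncidence_of_not_connected (X : DiMultigraph V E) (w : V)
    {T : Finset (Option E)} (hT : ¬ (X.edgeGraph (edgesOf T)).Connected) (e : V ≃ T) :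
    ((X.rootedIncidence w).submatrix id fun i => (e i : Option E)).det = 0 := by
  classical
  obtain ⟨v, hv⟩ : ∃ v, ¬ (X.edgeGraph (edgesOf T)).Reachable w v := by
    by_contra! h
    exact hT ((SimpleGraph.connected_iff_exists_forall_reachable _).2 ⟨w, h⟩)
  -- The indicator of the vertices not reachable from `w` is constant along each chosen edge and
  -- vanishes at `w`, so it lies in the left kernel.
  refine exists_vecMul_eq_zero_iff.1
    ⟨fun u => if (X.edgeGraph (edgesOf T)).Reachable w u then 0 else 1,
      fun h0 => by simpa [hv] using congrFun h0 v, ?_⟩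
  ext j
  rcases h : (e j : Option E) with _ | f
  · simp [vecMul, dotProduct, rootedIncidence, h]
  · have hf : f ∈ edgesOf T := show some f ∈ T from h ▸ (e j).2
    have hr : (X.edgeGraph (edgesOf T)).Reachable (X.src f) (X.tgt f) := by
      by_cases hst : X.src f = X.tgt f
      · rw [hst]
      · exact ((X.edgeGraph_adj _).2 ⟨hst, f, hf, Or.inl ⟨rfl, rfl⟩⟩).reachable
    have hiff : (X.edgeGraph (edgesOf T)).Reachable w (X.src f) ↔
        (X.edgeGraph (edgesOf T)).Reachable w (X.tgt f) :=
      ⟨fun h => h.trans hr, fun h => h.trans hr.symm⟩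
    simp [vecMul, dotProduct, rootedIncidence, h, mul_sub, hiff]

/-- The column span contains `e_w` and the difference of the endpoints of each chosen edge, so
following walks from `w` puts every `e_v` in it. -/
theorem isUnit_det_rootedIncidence (X : DiMultigraph V E) (w : V)
    {T : Finset (Option E)} (hnone : none ∈ T) (hT : (X.edgeGraph (edgesOf T)).Connected)
    (e : V ≃ T) :
    IsUnit ((X.rootedIncidence w).submatrix id fun i => (e i : Option E)).det := by
  set B := (X.rootedIncidence w).submatrix id fun i => (e i : Option E) with hB
  have hcol : ∀ o ∈ T, (fun v => X.rootedIncidence w v o) ∈ LinearMap.range B.mulVecLin := by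
    intro o ho
    convert col_mem_range_mulVecLin B (e.symm ⟨o, ho⟩) using 2
    simp [hB]
  have hw : Pi.single w 1 ∈ LinearMap.range B.mulVecLin := by
    convert hcol none hnone using 1
    ext v
    simp [rootedIncidence, Pi.single_apply, eq_comm]
  have hedge : ∀ f ∈ edgesOf T, (Pi.single (X.tgt f) 1 - Pi.single (X.src f) 1 : V → ℤ) ∈
      LinearMap.range B.mulVecLin := by
    intro f hf
    convert hcol (some f) hf using 1
    ext v
    simp [rootedIncidence, Pi.single_apply, eq_comm]
  have hstep : ∀ {u v : V}, (X.edgeGraph (edgesOf T)).Walk u v →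
      (Pi.single u 1 : V → ℤ) ∈ LinearMap.range B.mulVecLin →
      (Pi.single v 1 : V → ℤ) ∈ LinearMap.range B.mulVecLin := by
    intro u v p
    induction p with
    | nil => exact id
    | cons hadj _ ih =>
      intro hu
      refine ih ?_
      obtain ⟨-, f, hf, ⟨rfl, rfl⟩ | ⟨rfl, rfl⟩⟩ := (X.edgeGraph_adj _).1 hadj
      · simpa using add_mem hu (hedge f hf)
      · simpa using sub_mem hu (hedge f hf)
  exact isUnit_det_of_forall_single fun v =>
    (hT.preconnected w v).elim fun p => hstep p hw

variable [Fintype E]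

/-- The Laplacian of `X`, twisted by `x` along the edges of `X` and by `y` against them. -/
def twistedLaplacian {V E R : Type*} [DecidableEq V] [Fintype E] [CommRing R]
    (X : DiMultigraph V E) (x y : R) : Matrix V V R :=
  Matrix.of fun u v => ∑ e,
    ((if X.tgt e = u then 1 else 0) * (if X.tgt e = v then 1 else 0)
      + (if X.src e = u then 1 else 0) * (if X.src e = v then 1 else 0)
      - x * ((if X.src e = u then 1 else 0) * (if X.tgt e = v then 1 else 0))
      - y * ((if X.tgt e = u then 1 else 0) * (if X.src e = v then 1 else 0)))

theorem rootedIncidence_mul_transpose {V E : Type*} [DecidableEq V] [Fintype E] (X : DiMultigraph V E) (w : V) :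
    X.rootedIncidence w * (X.rootedIncidence w)ᵀ =
      X.twistedLaplacian 1 1 + vecMulVec (Pi.single w 1) (Pi.single w 1) := by
  ext u v
  rw [mul_apply, Fintype.sum_option, add_comm]
  simp only [rootedIncidence, twistedLaplacian, transpose_apply, of_apply, Option.elim,
    Matrix.add_apply, vecMulVec_apply, Pi.single_apply, @eq_comm _ u w, @eq_comm _ v w]
  congr 1
  exact Finset.sum_congr rfl fun e _ => by ring

-- The extra column `none` accounts for the `-1` in the edge count of a tree, so spanning trees
-- become the nonvanishing terms of Cauchy–Binet.
open Classical in
theorem numSpanningTrees_eq_card (X : DiMultigraph V E) :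
    X.numSpanningTrees = ((Finset.powersetCard (Fintype.card V) Finset.univ).filter
      fun T : Finset (Option E) => none ∈ T ∧ (X.edgeGraph (edgesOf T)).Connected).card := by
  rw [numSpanningTrees, ← Set.ncard_coe_finset]
  have hE : ∀ S : Set E, edgesOf (Finset.insertNone S.toFinset) = S := fun S => by
    ext e; simp [edgesOf]
  refine Set.ncard_congr (fun S _ => Finset.insertNone S.toFinset) ?_ ?_ ?_
  · intro S hS
    rw [Finset.mem_coe, Finset.mem_filter, Finset.mem_powersetCard, hE, Finset.card_insertNone,
      ← Set.ncard_eq_toFinset_card', hS.2, Nat.card_eq_fintype_card]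
    exact ⟨⟨Finset.subset_univ _, rfl⟩, by simp, hS.1⟩
  · intro S S' _ _ h
    rw [← hE S, h, hE]
  · intro T hT
    rw [Finset.mem_coe, Finset.mem_filter, Finset.mem_powersetCard] at hT
    have hT' : Finset.insertNone (edgesOf T).toFinset = T := by
      ext o
      cases o with
      | none => simp [hT.2.1]
      | some e => rw [Finset.some_mem_insertNone, Set.mem_toFinset]; rfl
    refine ⟨edgesOf T, ⟨hT.2.2, ?_⟩, hT'⟩
    rw [Set.ncard_eq_toFinset_card', ← Finset.card_insertNone, hT', hT.1.2,
      Nat.card_eq_fintype_card]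

/-- Kirchhoff's matrix-tree theorem. -/
theorem det_twistedLaplacian_add_eq_numSpanningTrees (X : DiMultigraph V E) (w : V) :
    (X.twistedLaplacian 1 1 + vecMulVec (Pi.single w 1) (Pi.single w 1) : Matrix V V ℤ).det =
      X.numSpanningTrees := by
  classical
  rw [← rootedIncidence_mul_transpose, numSpanningTrees_eq_card, Finset.card_filter, Nat.cast_sum,
    det_mul_eq_sum_powersetCard _ _
      (fun T => ((if none ∈ T ∧ (X.edgeGraph (edgesOf T)).Connected then 1 else 0 : ℕ) : ℤ))]
  intro T e
  have ht : ((X.rootedIncidence w)ᵀ.submatrix (fun i => (e i : Option E)) id) =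
      ((X.rootedIncidence w).submatrix id fun i => (e i : Option E))ᵀ := rfl
  rw [ht, det_transpose]
  split_ifs with h
  · rw [Nat.cast_one, Int.isUnit_mul_self (X.isUnit_det_rootedIncidence w h.1 h.2 e)]
  · by_cases hn : none ∈ T
    · simp [X.det_rootedIncidence_of_not_connected w (fun hc => h ⟨hn, hc⟩) e]
    · simp [X.det_rootedIncidence_of_none_notMem w hn e]

end DiMultigraph

/-! ### The twisted Laplacian of a balanced graph and `M_X` modulo `T³`. -/

namespace DiMultigraph

open Matrix

section twisted

variable {V E R : Type*} [Fintype V] [DecidableEq V] [Fintype E] [CommRing R]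

theorem ite_and_eq_mul (R : Type*) [CommRing R] (P Q : Prop) [Decidable P] [Decidable Q] :
    (if P ∧ Q then (1 : R) else 0) = (if P then 1 else 0) * (if Q then 1 else 0) := by
  split_ifs <;> simp_all

theorem cast_outDegree {V E R : Type*} [DecidableEq V] [Fintype E] [CommRing R]
    (X : DiMultigraph V E) (v : V) :
    (X.outDegree v : R) = ∑ e, if X.src e = v then 1 else 0 := by
  rw [outDegree, Nat.card_eq_fintype_card, Fintype.card_subtype, Finset.card_filter]
  simp

theorem cast_inDegree {V E R : Type*} [DecidableEq V] [Fintype E] [CommRing R]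
    (X : DiMultigraph V E) (v : V) :
    (X.inDegree v : R) = ∑ e, if X.tgt e = v then 1 else 0 := by
  rw [inDegree, Nat.card_eq_fintype_card, Fintype.card_subtype, Finset.card_filter]
  simp

theorem twistedLaplacian_mulVec_one_apply (X : DiMultigraph V E) (x y : R) (v : V) :
    (X.twistedLaplacian x y *ᵥ 1) v = (1 - x) * X.outDegree v + (1 - y) * X.inDegree v := by
  rw [cast_outDegree, cast_inDegree, Finset.mul_sum, Finset.mul_sum, ← Finset.sum_add_distrib]
  simp only [mulVec, dotProduct, twistedLaplacian, of_apply, Pi.one_apply, mul_one]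
  rw [Finset.sum_comm]
  refine Finset.sum_congr rfl fun e _ => ?_
  simp only [Finset.sum_add_distrib, Finset.sum_sub_distrib, ← Finset.mul_sum, Finset.sum_ite_eq,
    Finset.mem_univ, if_true]
  ring

theorem twistedLaplacian_transpose {V E : Type*} [DecidableEq V] [Fintype E]
    (X : DiMultigraph V E) (x y : R) :
    (X.twistedLaplacian x y)ᵀ = X.twistedLaplacian y x := by
  ext u v
  simp only [twistedLaplacian, transpose_apply, of_apply]
  exact Finset.sum_congr rfl fun e _ => by ring

theorem twistedLaplacian_one_mulVec_one (X : DiMultigraph V E) :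
    (X.twistedLaplacian 1 1 : Matrix V V R) *ᵥ 1 = 0 := by
  ext v
  simp [twistedLaplacian_mulVec_one_apply]

theorem one_vecMul_twistedLaplacian_one (X : DiMultigraph V E) :
    1 ᵥ* (X.twistedLaplacian 1 1 : Matrix V V R) = 0 := by
  rw [← mulVec_transpose, twistedLaplacian_transpose, twistedLaplacian_one_mulVec_one]

theorem IsBalanced.twistedLaplacian_mulVec_one {X : DiMultigraph V E} (h : X.IsBalanced)
    (x y : R) :
    X.twistedLaplacian x y *ᵥ 1 = (2 - x - y) • fun v => (X.outDegree v : R) := by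
  ext v
  rw [twistedLaplacian_mulVec_one_apply, h v, Pi.smul_apply, smul_eq_mul]
  ring

theorem map_twistedLaplacian {V E S : Type*} [DecidableEq V] [Fintype E] [CommRing S]
    (X : DiMultigraph V E) (f : R →+* S) (x y : R) :
    (X.twistedLaplacian x y).map f = X.twistedLaplacian (f x) (f y) := by
  ext u v
  simp [twistedLaplacian, apply_ite f]

/-- The determinant of the twisted Laplacian with the column `w` replaced by the out-degrees. -/
noncomputable def degreeCofactor (X : DiMultigraph V E) (w : V) (x y : R) : R :=
  ((X.twistedLaplacian x y).updateCol w fun v => (X.outDegree v : R)).det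

theorem map_degreeCofactor {S : Type*} [CommRing S] (X : DiMultigraph V E) (w : V)
    (f : R →+* S) (x y : R) :
    f (X.degreeCofactor w x y) = X.degreeCofactor w (f x) (f y) := by
  rw [degreeCofactor, degreeCofactor, RingHom.map_det, RingHom.mapMatrix_apply, map_updateCol,
    map_twistedLaplacian]
  congr 2
  ext v
  simp

theorem IsBalanced.det_twistedLaplacian {X : DiMultigraph V E} (h : X.IsBalanced) (w : V)
    (x y : R) : (X.twistedLaplacian x y).det = (2 - x - y) * X.degreeCofactor w x y :=
  det_eq_mul_det_updateCol (h.twistedLaplacian_mulVec_one x y) w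

theorem det_twistedLaplacian_updateCol_single (X : DiMultigraph V E) (w : V) :
    ((X.twistedLaplacian 1 1 : Matrix V V ℤ).updateCol w (Pi.single w 1)).det =
      X.numSpanningTrees := by
  rw [← det_twistedLaplacian_add_eq_numSpanningTrees X w,
    det_add_vecMulVec_of_one_mulVec_eq_zero X.twistedLaplacian_one_mulVec_one
      X.one_vecMul_twistedLaplacian_one _ _ w]
  simp

theorem IsBalanced.sum_outDegree {V E : Type*} [Fintype V] {X : DiMultigraph V E} (h : X.IsBalanced) :
    ∑ v, X.outDegree v = X.totalInDegree :=
  Finset.sum_congr rfl fun v _ => (h v).symm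

/-- The cofactor argument needs a domain, so the value is found over `ℤ` and carried to `R` by base
change. -/
theorem IsBalanced.degreeCofactor_one {X : DiMultigraph V E} (h : X.IsBalanced) (w : V) :
    X.degreeCofactor w (1 : R) 1 = (X.totalInDegree * X.numSpanningTrees : ℕ) := by
  have hZ : X.degreeCofactor w (1 : ℤ) 1 = (X.totalInDegree * X.numSpanningTrees : ℕ) := by
    rw [degreeCofactor, det_updateCol_eq_sum_mul X.one_vecMul_twistedLaplacian_one,
      det_twistedLaplacian_updateCol_single, ← h.sum_outDegree]
    push_cast
    rfl
  have := X.map_degreeCofactor w (Int.castRingHom R) 1 1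
  rw [hZ] at this
  simpa using this.symm

theorem charSeries_eq_det (X : DiMultigraph V E) (p : ℕ) [Fact p.Prime] :
    X.charSeries p = (X.twistedLaplacian (1 + PowerSeries.X)
      (PowerSeries.invOfUnit (1 + PowerSeries.X) 1) : Matrix V V (PowerSeries ℤ_[p])).det := by
  rw [charSeries]
  congr 1
  ext1 u v
  have hadj : ∀ u v, X.adjMatrix (PowerSeries ℤ_[p]) u v =
      ∑ e, (if X.src e = u then 1 else 0) * (if X.tgt e = v then 1 else 0) := fun u v => by
    simp only [adjMatrix, of_apply, ← ite_and_eq_mul]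
    rw [Nat.card_eq_fintype_card, Fintype.card_subtype, Finset.card_filter, Nat.cast_sum]
    simp
  have hval : X.valencyMatrix (PowerSeries ℤ_[p]) u v =
      ∑ e, ((if X.tgt e = u then 1 else 0) * (if X.tgt e = v then 1 else 0)
        + (if X.src e = u then 1 else 0) * (if X.src e = v then 1 else 0)) := by
    rw [valencyMatrix, diagonal_apply, Nat.cast_add, cast_inDegree, cast_outDegree,
      ← Finset.sum_add_distrib]
    split_ifs with h
    · subst h
      exact Finset.sum_congr rfl fun e _ => by simp only [← ite_and_eq_mul, and_self]
    · refine (Finset.sum_eq_zero fun e _ => ?_).symm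
      have h1 : ∀ z, (if z = u then (1 : PowerSeries ℤ_[p]) else 0) * (if z = v then 1 else 0) = 0 := by
        intro z
        by_cases hz : z = u
        · simp [hz, h]
        · simp [hz]
      rw [h1, h1, add_zero]
  simp only [Matrix.sub_apply, Matrix.smul_apply, transpose_apply, hadj, hval, twistedLaplacian,
    of_apply, smul_eq_mul, Finset.mul_sum, ← Finset.sum_sub_distrib]
  refine Finset.sum_congr rfl fun e _ => by ring

theorem IsBalanced.X_pow_three_dvd_charSeries {X : DiMultigraph V E} (h : X.IsBalanced) (w : V)
    (p : ℕ) [Fact p.Prime] :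
    (PowerSeries.X : PowerSeries ℤ_[p]) ^ 3 ∣
      X.charSeries p
        - (-((X.totalInDegree * X.numSpanningTrees : ℕ) : PowerSeries ℤ_[p])
            * PowerSeries.X ^ 2) := by
  rw [charSeries_eq_det, h.det_twistedLaplacian w]
  set y : PowerSeries ℤ_[p] := PowerSeries.invOfUnit (1 + PowerSeries.X) 1 with hy
  have hxy : (1 + PowerSeries.X) * y = 1 := PowerSeries.mul_invOfUnit _ _ (by simp)
  set c := X.degreeCofactor w (1 + PowerSeries.X) y with hc
  -- Setting `T = 0` sends both twists to `1`, so the constant term of `y * c` is `k κ_X`.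
  have hdvd : PowerSeries.X ∣
      y * c - ((X.totalInDegree * X.numSpanningTrees : ℕ) : PowerSeries ℤ_[p]) := by
    have hy1 : PowerSeries.constantCoeff y = 1 := by simp [hy]
    rw [PowerSeries.X_dvd_iff, map_sub, map_mul, hc, map_degreeCofactor, hy1, map_natCast]
    simp [h.degreeCofactor_one w]
  obtain ⟨q, hq⟩ := hdvd
  refine ⟨-q, ?_⟩
  -- This uses `2 - (1 + T) - y = -T² y`, a consequence of `(1 + T) y = 1`.
  linear_combination (-PowerSeries.X ^ 2) * hq + (PowerSeries.X - 1) * c * hxy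

end twisted

/-! ### Translation matrices and the Laplacian of a derived graph. -/

section cover

variable {V E G : Type*} [DecidableEq V] [Fintype E] [AddCommGroup G] [Fintype G] [DecidableEq G]

/-- The permutation matrix of the translation by `g`. -/
def translationMatrix {G : Type*} [AddCommGroup G] [DecidableEq G] (R : Type*) [CommRing R] (g : G) :
    Matrix G G R :=
  Matrix.of fun σ τ => if σ + g = τ then 1 else 0

theorem translationMatrix_zero {G : Type*} [AddCommGroup G] [DecidableEq G] (R : Type*)
    [CommRing R] : translationMatrix R (0 : G) = 1 := by
  ext σ τ
  simp [translationMatrix, Matrix.one_apply]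

theorem translationMatrix_mul (R : Type*) [CommRing R] (g h : G) :
    translationMatrix R g * translationMatrix R h = translationMatrix R (g + h) := by
  ext σ τ
  simp only [translationMatrix, mul_apply, of_apply, ite_mul, one_mul, zero_mul,
    Finset.sum_ite_eq, Finset.mem_univ, if_true, add_assoc]

theorem translationMatrix_pow (R : Type*) [CommRing R] (g : G) (i : ℕ) :
    translationMatrix R g ^ i = translationMatrix R (i • g) := by
  induction i with
  | zero => simp [translationMatrix_zero]
  | succ i ih => rw [pow_succ, ih, translationMatrix_mul, succ_nsmul]

theorem translationMatrix_transpose {G : Type*} [AddCommGroup G] [DecidableEq G] (R : Type*)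
    [CommRing R] (g : G) : (translationMatrix R g)ᵀ = translationMatrix R (-g) := by
  ext σ τ
  simp only [translationMatrix, transpose_apply, of_apply, ← sub_eq_add_neg, sub_eq_iff_eq_add,
    @eq_comm _ σ]

theorem translationMatrix_mulVec_one (R : Type*) [CommRing R] (g : G) :
    translationMatrix R g *ᵥ 1 = 1 := by
  ext σ
  simp [translationMatrix, mulVec, dotProduct]

theorem one_vecMul_translationMatrix (R : Type*) [CommRing R] (g : G) :
    1 ᵥ* translationMatrix R g = 1 := by
  rw [← mulVec_transpose, translationMatrix_transpose, translationMatrix_mulVec_one]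

/-- Keeping the twists in a commutative ring `S` allows the block determinant to be computed as a
determinant over `S` followed by `f`. -/
theorem comp_map_twistedLaplacian {S : Type*} [CommRing S] (X : DiMultigraph V E) (a : G)
    (f : S →+* Matrix G G ℤ) {x y : S} (hx : f x = translationMatrix ℤ a)
    (hy : f y = translationMatrix ℤ (-a)) :
    comp V V G G ℤ ((X.twistedLaplacian x y).map f) =
      (X.derived fun _ => a).twistedLaplacian 1 1 := by
  ext ⟨u, σ⟩ ⟨v, τ⟩
  simp only [comp_apply, map_apply, twistedLaplacian, of_apply, map_sum, derived,
    Fintype.sum_prod_type, Matrix.sum_apply]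
  refine Finset.sum_congr rfl fun e _ => ?_
  have hite : ∀ (P : Prop) [Decidable P], f (if P then 1 else 0) = if P then 1 else 0 :=
    fun P _ => by split_ifs <;> simp
  have hone : ∀ b : G, ∑ ρ, (if ρ + b = σ then (1 : ℤ) else 0) * (if ρ + b = τ then 1 else 0) =
      (1 : Matrix G G ℤ) σ τ := fun b => by
    simp [← eq_sub_iff_add_eq, one_apply, @eq_comm _ τ]
  have hpos : ∑ ρ, (if ρ = σ then (1 : ℤ) else 0) * (if ρ + a = τ then 1 else 0) =
      translationMatrix ℤ a σ τ := by
    simp only [translationMatrix, of_apply, ite_mul, one_mul, zero_mul, Finset.sum_ite_eq',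
      Finset.mem_univ, if_true]
  have hneg : ∑ ρ, (if ρ + a = σ then (1 : ℤ) else 0) * (if ρ = τ then 1 else 0) =
      translationMatrix ℤ (-a) σ τ := by
    rw [← translationMatrix_transpose]
    simp [translationMatrix]
  have hzero := hone 0
  simp only [add_zero] at hzero
  have hsum : ∀ (α β : ℤ) (g h : G → ℤ),
      ∑ ρ, α * g ρ * (β * h ρ) = α * β * ∑ ρ, g ρ * h ρ := fun α β g h => by
    rw [Finset.mul_sum]
    exact Finset.sum_congr rfl fun ρ _ => by ring
  simp only [map_sub, map_add, map_mul, hite, hx, hy, Matrix.sub_apply, Matrix.add_apply,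
    Prod.mk.injEq, ite_and_eq_mul, one_mul, Finset.sum_add_distrib, Finset.sum_sub_distrib,
    hsum, hone, hpos, hneg, hzero]
  split_ifs <;> simp

end cover

end DiMultigraph

/-! ### Cyclic translations and the determinant of a cycle. -/

namespace DiMultigraph

open Matrix Polynomial

section zmod

variable {N : ℕ} [NeZero N]

theorem sum_translationMatrix_pow {a : ZMod N} (ha : IsUnit a) :
    ∑ i ∈ Finset.range N, translationMatrix ℤ a ^ i = vecMulVec 1 1 := by
  have hbij : Function.Bijective fun i : Fin N => ((i : ℕ) : ZMod N) * a := by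
    refine (Fintype.bijective_iff_injective_and_card _).2 ⟨fun i j hij => ?_, by simp [ZMod.card]⟩
    have h := (ZMod.natCast_eq_natCast_iff' _ _ _).1 (ha.mul_right_cancel hij)
    rw [Nat.mod_eq_of_lt i.2, Nat.mod_eq_of_lt j.2] at h
    exact Fin.ext h
  ext σ τ
  simp only [Finset.sum_range, Matrix.sum_apply, translationMatrix_pow]
  simp only [translationMatrix, of_apply, nsmul_eq_mul, vecMulVec_apply,
    Pi.one_apply, mul_one]
  rw [hbij.sum_comp (fun g => if σ + g = τ then (1 : ℤ) else 0)]
  simp [← eq_sub_iff_add_eq']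

/-- Column `τ` of `1 - P` is `e_τ - e_{τ - a}`; starting from `e_w` and stepping by the generator
`a` reaches every basis vector. -/
theorem isUnit_det_one_sub_translationMatrix_updateCol {a : ZMod N} (ha : IsUnit a) (w : ZMod N) :
    IsUnit ((1 - translationMatrix ℤ a).updateCol w (Pi.single w 1)).det := by
  set B := (1 - translationMatrix ℤ a).updateCol w (Pi.single w 1) with hB
  have hmem : ∀ i : ℕ, (Pi.single (w + i * a) 1 : ZMod N → ℤ) ∈ LinearMap.range B.mulVecLin := by
    intro i
    induction i with
    | zero =>
      convert col_mem_range_mulVecLin B w using 1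
      ext v
      simp [hB]
    | succ i ih =>
      -- When the steps return to `w`, that column has been replaced by `e_w`, which is already the
      -- desired vector.
      by_cases hw : w + (i + 1 : ℕ) * a = w
      · rw [hw]
        convert col_mem_range_mulVecLin B w using 1
        ext v
        simp [hB]
      · convert add_mem ih (col_mem_range_mulVecLin B (w + (i + 1 : ℕ) * a)) using 1
        ext v
        have hv : v + a = w + (i + 1 : ℕ) * a ↔ v = w + i * a := by
          push_cast
          rw [add_one_mul, ← add_assoc, add_left_inj]
        simp only [hB, updateCol_apply, hw, if_false, Pi.add_apply, Matrix.sub_apply, one_apply,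
          translationMatrix, of_apply, hv, Pi.single_apply]
        ring
  refine isUnit_det_of_forall_single fun v => ?_
  obtain ⟨b, hb⟩ := ha.exists_left_inv
  convert hmem ((v - w) * b).val using 2
  rw [ZMod.natCast_zmod_val, mul_assoc, hb]
  ring

theorem det_one_sub_translationMatrix_sq {a : ZMod N} (ha : IsUnit a) :
    (1 - translationMatrix ℤ a + vecMulVec 1 1).det ^ 2 = (N : ℤ) ^ 4 := by
  have hr : (1 - translationMatrix ℤ a) *ᵥ 1 = 0 := by
    rw [sub_mulVec, one_mulVec, translationMatrix_mulVec_one, sub_self]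
  have hl : 1 ᵥ* (1 - translationMatrix ℤ a) = 0 := by
    rw [vecMul_sub, vecMul_one, one_vecMul_translationMatrix, sub_self]
  have hu := Int.isUnit_mul_self (isUnit_det_one_sub_translationMatrix_updateCol ha 0)
  rw [det_add_vecMulVec_of_one_mulVec_eq_zero hr hl 1 1 0]
  simp only [Pi.one_apply, Finset.sum_const, Finset.card_univ, ZMod.card, nsmul_eq_mul, mul_one]
  linear_combination (N : ℤ) ^ 4 * hu

/-- With `J` the all-ones matrix, `PJ = JP⁻¹ = J` and `J² = NJ`, so the matrix is `(1 - P + J)(1 - P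
+ J)ᵗ`. -/
theorem det_cycle {a : ZMod N} (ha : IsUnit a) :
    (2 - translationMatrix ℤ a - translationMatrix ℤ (-a) + (N : Matrix (ZMod N) (ZMod N) ℤ) *
      vecMulVec 1 1).det = (N : ℤ) ^ 4 := by
  rw [← det_one_sub_translationMatrix_sq ha, sq]
  conv_rhs => enter [2]; rw [← det_transpose (1 - translationMatrix ℤ a + vecMulVec 1 1)]
  rw [← det_mul, transpose_add, transpose_sub, transpose_one, translationMatrix_transpose,
    transpose_vecMulVec]
  congr 1
  have h1 : translationMatrix ℤ a * vecMulVec 1 1 = vecMulVec 1 1 := by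
    rw [mul_vecMulVec, translationMatrix_mulVec_one]
  have h2 : vecMulVec (1 : ZMod N → ℤ) 1 * translationMatrix ℤ (-a) = vecMulVec 1 1 := by
    rw [vecMulVec_mul, one_vecMul_translationMatrix]
  have h3 : vecMulVec (1 : ZMod N → ℤ) 1 * vecMulVec 1 1 =
      (N : Matrix (ZMod N) (ZMod N) ℤ) * vecMulVec 1 1 := by
    rw [vecMulVec_mul_vecMulVec]
    ext σ τ
    rw [← diagonal_natCast, diagonal_mul]
    simp [vecMulVec_apply]
  have h4 : translationMatrix ℤ a * translationMatrix ℤ (-a) = 1 := by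
    rw [translationMatrix_mul, add_neg_cancel, translationMatrix_zero]
  have h5 : (1 - translationMatrix ℤ a + vecMulVec 1 1) *
      (1 - translationMatrix ℤ (-a) + vecMulVec 1 1) =
      1 - translationMatrix ℤ a - translationMatrix ℤ (-a)
        + translationMatrix ℤ a * translationMatrix ℤ (-a)
        + (vecMulVec 1 1 - translationMatrix ℤ a * vecMulVec 1 1)
        + (vecMulVec 1 1 - vecMulVec 1 1 * translationMatrix ℤ (-a))
        + vecMulVec 1 1 * vecMulVec 1 1 := by noncomm_ring
  rw [h5, h1, h2, h3, h4, sub_self, add_zero, add_zero, ← one_add_one_eq_two]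
  abel

end zmod

/-! ### Spanning trees of cyclic covers. -/

section cover

variable {V E : Type*} [Fintype V] [DecidableEq V] [Fintype E] {p n : ℕ} [Fact p.Prime]

/-- Evaluation of integral polynomials at a translation matrix. -/
noncomputable def evalTranslation {G : Type*} [AddCommGroup G] [Fintype G] [DecidableEq G] (a : G) :
    ℤ[X] →+* Matrix G G ℤ :=
  (aeval (translationMatrix ℤ a)).toRingHom

theorem evalTranslation_X {G : Type*} [AddCommGroup G] [Fintype G] [DecidableEq G] (a : G) :
    evalTranslation a X = translationMatrix ℤ a := by
  simp [evalTranslation]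

/-- Since `P ^ N = 1`, the power `X ^ (N - 1)` serves as the inverse of `X` while staying in the
polynomial ring. -/
theorem evalTranslation_X_pow {N : ℕ} [NeZero N] (a : ZMod N) :
    evalTranslation a (X ^ (N - 1)) = translationMatrix ℤ (-a) := by
  rw [map_pow, evalTranslation_X, translationMatrix_pow, nsmul_eq_mul, Nat.cast_sub NeZero.one_le]
  simp

theorem not_dvd_det_evalTranslation (a : ZMod (p ^ n)) {c : ℤ[X]}
    (hc : ¬ (p : ℤ) ∣ c.eval 1) : ¬ (p : ℤ) ∣ (evalTranslation a c).det := by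
  let g : ℤ[X] →+* Matrix (ZMod (p ^ n)) (ZMod (p ^ n)) (ZMod p) :=
    (Int.castRingHom (ZMod p)).mapMatrix.comp (evalTranslation a)
  have hgX : g X = translationMatrix (ZMod p) a := by
    simp only [g, RingHom.comp_apply, evalTranslation_X, RingHom.mapMatrix_apply]
    ext σ τ
    simp [translationMatrix, apply_ite]
  -- In characteristic `p`, `(P - 1) ^ (p ^ n) = P ^ (p ^ n) - 1 = 0`.
  have hnil : IsNilpotent (g (X - 1)) := by
    refine ⟨p ^ n, ?_⟩
    rw [map_sub, map_one, hgX, sub_pow_char_pow_of_commute _ _ (Commute.one_right _), one_pow,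
      translationMatrix_pow]
    simp [translationMatrix_zero]
  obtain ⟨q, hq⟩ : X - 1 ∣ c - C (c.eval 1) := by
    simpa using X_sub_C_dvd_sub_C_eval (p := c) (a := 1)
  have hu : IsUnit (g (C (c.eval 1))) := by
    have : IsUnit ((c.eval 1 : ℤ) : ZMod p) :=
      isUnit_iff_ne_zero.2 fun h => hc ((ZMod.intCast_zmod_eq_zero_iff_dvd _ _).1 h)
    have h2 := this.map (Matrix.scalar (ZMod (p ^ n)) : ZMod p →+* _)
    simpa using h2
  have hunit : IsUnit (g c) := by
    rw [← sub_add_cancel c (C (c.eval 1)), hq, map_add, map_mul, add_comm]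
    refine IsNilpotent.isUnit_add_left_of_commute ?_ hu ?_
    · exact Commute.isNilpotent_mul_right ((Commute.all (X - 1) q).map g) hnil
    · rw [← map_mul]
      exact (Commute.all _ _).map g
  intro hdvd
  have hdet : (g c).det = 0 := by
    rw [← (ZMod.intCast_zmod_eq_zero_iff_dvd _ _).2 hdvd]
    exact ((Int.castRingHom (ZMod p)).map_det _).symm
  exact ((isUnit_iff_isUnit_det _).1 hunit).ne_zero hdet

/-- Without perturbation both determinants vanish. A rank-one term in the direction of the degree
vector `d` keeps `1` mapped to a multiple of `d`, so the cofactor still splits off. -/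
theorem IsBalanced.totalInDegree_mul_numSpanningTrees_derived {X : DiMultigraph V E}
    (h : X.IsBalanced) (w : V) {N : ℕ} [NeZero N] {a : ZMod N} (ha : IsUnit a) :
    (X.totalInDegree * (X.derived fun _ => a).numSpanningTrees : ℤ) =
      N * (evalTranslation a (X.degreeCofactor w Polynomial.X (Polynomial.X ^ (N - 1)))).det := by
  let x : ℤ[X] := Polynomial.X
  let y : ℤ[X] := Polynomial.X ^ (N - 1)
  -- The factor `N` makes `2 - x - y + j` evaluate to the matrix of `det_cycle`.
  let j : ℤ[X] := (N : ℤ[X]) * ∑ i ∈ Finset.range N, (Polynomial.X : ℤ[X]) ^ i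
  have hj : evalTranslation a j = (N : Matrix (ZMod N) (ZMod N) ℤ) * vecMulVec 1 1 := by
    simp only [j, map_mul, map_natCast, map_sum, map_pow, evalTranslation_X,
      sum_translationMatrix_pow ha]
  let d : V → ℤ[X] := fun v => X.outDegree v
  let B : Matrix V V ℤ[X] := X.twistedLaplacian x y + vecMulVec d (Pi.single w j)
  have hB : B.det = (2 - x - y + j) * X.degreeCofactor w x y := by
    refine det_add_vecMulVec_of_mulVec_one ?_ w
    rw [add_mulVec, h.twistedLaplacian_mulVec_one, vecMulVec_mulVec, add_smul]
    congr 1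
    ext v
    simp [d, mul_comm]
  have hcomp : comp V V _ _ ℤ (B.map (evalTranslation a)) =
      (X.derived fun _ => a).twistedLaplacian 1 1 +
        vecMulVec (fun z => (N * X.outDegree z.1 : ℤ)) (fun z => if z.1 = w then 1 else 0) := by
    rw [← X.comp_map_twistedLaplacian a _ (evalTranslation_X a) (evalTranslation_X_pow a)]
    ext ⟨u, σ⟩ ⟨v, τ⟩
    simp only [B, comp_apply, map_apply, Matrix.add_apply, map_add, vecMulVec_apply, x, y, d,
      map_mul, map_natCast, Pi.single_apply, apply_ite (evalTranslation a), hj, map_zero]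
    congr 1
    split_ifs with hv
    · rw [← diagonal_natCast, ← diagonal_natCast, diagonal_mul, diagonal_mul]
      simp [vecMulVec_apply, mul_comm]
    · simp
  have hdet := congrArg det hcomp
  -- One evaluation gives `N⁴ det c(P, P⁻¹)`; the other gives `(∑ u)(∑ v) κ` for the derived graph,
  -- with `∑ u = N² k` and `∑ v = N`.
  rw [← det_det, hB, map_mul, det_mul, map_add, map_sub, map_sub, map_ofNat, hj,
    evalTranslation_X, evalTranslation_X_pow, det_cycle ha,
    det_add_vecMulVec_of_one_mulVec_eq_zero (twistedLaplacian_one_mulVec_one _)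
      (one_vecMul_twistedLaplacian_one _) _ _ (w, 0), det_twistedLaplacian_updateCol_single] at hdet
  have hs1 : ∑ z : V × ZMod N, (N * X.outDegree z.1 : ℤ) = N * (N * X.totalInDegree) := by
    rw [Fintype.sum_prod_type, ← h.sum_outDegree]
    simp [Finset.mul_sum]
  have hs2 : ∑ z : V × ZMod N, (if z.1 = w then (1 : ℤ) else 0) = N := by
    rw [Fintype.sum_prod_type_right]
    simp
  rw [hs1, hs2] at hdet
  have hN : (N : ℤ) ^ 3 ≠ 0 := pow_ne_zero _ (Nat.cast_ne_zero.2 (NeZero.ne N))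
  refine mul_left_cancel₀ hN ?_
  linear_combination -hdet

theorem IsBalanced.numSpanningTrees_derived {X : DiMultigraph V E} (h : X.IsBalanced) [Nonempty V]
    (hp : ¬ p ∣ X.totalInDegree * X.numSpanningTrees) {a : ZMod (p ^ n)} (ha : IsUnit a) :
    (X.derived fun _ => a).numSpanningTrees ≠ 0 ∧
      padicValNat p (X.derived fun _ => a).numSpanningTrees = n := by
  obtain ⟨w⟩ := ‹Nonempty V›
  have hk := h.totalInDegree_mul_numSpanningTrees_derived w ha
  set δ := (evalTranslation a
    (X.degreeCofactor w Polynomial.X (Polynomial.X ^ (p ^ n - 1)))).det with hδ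
  have hδp : ¬ (p : ℤ) ∣ δ := by
    refine not_dvd_det_evalTranslation a ?_
    have := X.map_degreeCofactor w (evalRingHom (1 : ℤ)) Polynomial.X
      (Polynomial.X ^ (p ^ n - 1))
    simp only [coe_evalRingHom, eval_X, eval_pow, one_pow, h.degreeCofactor_one] at this
    rw [this]
    exact_mod_cast hp
  have hkp : ¬ p ∣ X.totalInDegree := fun hd => hp (hd.mul_right _)
  have hk' := congrArg Int.natAbs hk
  simp only [Int.natAbs_mul, Int.natAbs_natCast] at hk'
  have hδp' : ¬ p ∣ δ.natAbs := fun hd => hδp (Int.natCast_dvd.2 hd)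
  have hδ0 : δ.natAbs ≠ 0 := fun h0 => hδp' (h0 ▸ dvd_zero p)
  have hpn : p ^ n ≠ 0 := pow_ne_zero _ (Fact.out : p.Prime).ne_zero
  have hne := hk' ▸ mul_ne_zero hpn hδ0
  have hv := congrArg (padicValNat p) hk'
  rw [padicValNat.mul (left_ne_zero_of_mul hne) (right_ne_zero_of_mul hne),
    padicValNat.mul hpn hδ0, padicValNat.eq_zero_of_not_dvd hkp,
    padicValNat.eq_zero_of_not_dvd hδp', padicValNat.prime_pow, zero_add, add_zero] at hv
  exact ⟨right_ne_zero_of_mul hne, hv⟩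

end cover

end DiMultigraph

/-! ### Transport of spanning trees and connectedness. -/

namespace DiMultigraph

theorem numSpanningTrees_eq_of_equiv {V E V' E' : Type*} {X : DiMultigraph V E}
    {Y : DiMultigraph V' E'} (φ : V ≃ V') (ψ : E ≃ E') (hs : ∀ e, Y.src (ψ e) = φ (X.src e))
    (ht : ∀ e, Y.tgt (ψ e) = φ (X.tgt e)) : X.numSpanningTrees = Y.numSpanningTrees := by
  have hiso : ∀ S : Set E, Nonempty (X.edgeGraph S ≃g Y.edgeGraph (ψ '' S)) := fun S =>
    ⟨φ, by simp only [edgeGraph_adj, Set.exists_mem_image, hs, ht, φ.apply_eq_iff_eq, ne_eq,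
      implies_true]⟩
  have htree : ∀ S : Set E, X.IsSpanningTree S ↔ Y.IsSpanningTree (ψ '' S) := fun S => by
    obtain ⟨i⟩ := hiso S
    rw [IsSpanningTree, IsSpanningTree, i.connected_iff, Set.ncard_image_of_injective _ ψ.injective,
      Nat.card_congr φ]
  refine Set.ncard_congr (fun S _ => ψ '' S) (fun S hS => (htree S).1 hS)
    (fun S S' _ _ h => ψ.injective.image_injective h) fun S hS => ⟨ψ.symm '' S, ?_, ?_⟩
  · exact (htree _).2 (by simpa [Set.image_image] using hS)
  · simp [Set.image_image]

theorem numSpanningTrees_induce_univ {V E : Type*} (X : DiMultigraph V E) :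
    (X.induce Set.univ).numSpanningTrees = X.numSpanningTrees :=
  numSpanningTrees_eq_of_equiv (Equiv.Set.univ V) (Equiv.subtypeUnivEquiv fun _ => by simp)
    (fun _ => rfl) fun _ => rfl

theorem connected_of_numSpanningTrees_ne_zero {V E : Type*} {X : DiMultigraph V E}
    (h : X.numSpanningTrees ≠ 0) : X.Connected := by
  obtain ⟨S, hS, -⟩ := Set.nonempty_of_ncard_ne_zero h
  refine hS.mono fun u v huv => ?_
  obtain ⟨hne, e, -, he⟩ := (X.edgeGraph_adj _).1 huv
  exact (X.edgeGraph_adj _).2 ⟨hne, e, Set.mem_univ _, he⟩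

theorem Connected.component_eq {V E : Type*} {X : DiMultigraph V E} (h : X.Connected) (v : V)
    (C : X.Component) : X.component v = C := by
  induction C using SimpleGraph.ConnectedComponent.ind with
  | _ u => exact SimpleGraph.ConnectedComponent.eq.2 (h.preconnected v u)

theorem Connected.card_component {V E : Type*} {X : DiMultigraph V E} (h : X.Connected) :
    Nat.card X.Component = 1 := by
  obtain ⟨v⟩ := h.nonempty
  exact Nat.card_eq_one_iff_unique.2
    ⟨⟨fun C C' => by rw [← h.component_eq v C, h.component_eq v C']⟩, ⟨X.component v⟩⟩

end DiMultigraph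

theorem theoremD (p : ℕ) [Fact p.Prime] {V E : Type*} [Fintype V] [DecidableEq V] [Finite E]
    (X : DiMultigraph V E) (hconn : X.Connected) (hbal : X.IsBalanced) :
    ((PowerSeries.X : PowerSeries ℤ_[p]) ^ 3 ∣
      X.charSeries p
        - (-((X.totalInDegree * X.numSpanningTrees : ℕ) : PowerSeries ℤ_[p])
            * PowerSeries.X ^ 2)) ∧
    ((2 < p ∨ ∃ c : List (E ⊕ E), X.double.IsCycle c ∧
        IsCoprime (DiMultigraph.weight c) (p : ℤ)) →
      ¬ p ∣ X.totalInDegree * X.numSpanningTrees →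
      ∀ a : ℤ_[p], IsUnit a →
        ∃ n₀ : ℕ,
          IsLeast {m : ℕ | ∀ n ≥ m, X.numComponents p a n = X.numComponents p a m} n₀ ∧
          ∀ C : (X.constantCover p a n₀).Component,
            HasIwasawaInvariants p
              (fun n => (X.towerLayer p a n₀ C n).numSpanningTrees) 0 1) := by
  obtain ⟨_⟩ := nonempty_fintype E
  obtain ⟨w⟩ := hconn.nonempty
  have : Nonempty V := ⟨w⟩
  refine ⟨hbal.X_pow_three_dvd_charSeries w p, fun _ hp a ha => ?_⟩
  have hlayer : ∀ n, (X.constantCover p a n).numSpanningTrees ≠ 0 ∧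
      padicValNat p (X.constantCover p a n).numSpanningTrees = n := fun n =>
    hbal.numSpanningTrees_derived hp (ha.map (PadicInt.toZModPow n))
  have hcon : ∀ n, (X.constantCover p a n).Connected := fun n =>
    DiMultigraph.connected_of_numSpanningTrees_ne_zero (hlayer n).1
  -- All layers are connected, so the component count is constant from level `0`, and `ord_p κ_n =
  -- n` holds exactly, with `ν = 0`.
  refine ⟨0, ⟨fun n _ => (hcon n).card_component.trans (hcon 0).card_component.symm,
    fun _ _ => Nat.zero_le _⟩, fun C => ⟨0, Filter.Eventually.of_forall fun n => ?_⟩⟩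
  have hpre : X.preimage p a 0 C n = Set.univ :=
    Set.eq_univ_of_forall fun z => (hcon 0).component_eq _ C
  have hκ : (X.towerLayer p a 0 C n).numSpanningTrees =
      (X.constantCover p a (0 + n)).numSpanningTrees := by
    rw [DiMultigraph.towerLayer, hpre, DiMultigraph.numSpanningTrees_induce_univ]
  simp only [hκ]
  exact ⟨(hlayer _).1, by rw [(hlayer _).2]; simp⟩
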